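/- Let $X,Y$ be finite nonempty sets, $f:X\times Y\to\{0,1\}$, and $0\le\varepsilon<1/2$. Then $f$ can be computed with error $\varepsilon$ by a private two-party quantum protocol if and only if there are functions $f_A:X\to\{0,1\}$ and $f_B:Y\to\{0,1\}$ with $f(x,y)=f_A(x)\oplus f_B(y)$ for all $x\in X$, $y\in Y$. In particular, the Boolean functions computable by private quantum protocols (with any fixed error $\varepsilon<1/2$) are exactly those of the form $f_A(x)\oplus f_B(y)$. Here a quantum protocol uses a finite number of qubits, initially in the state $|0\rangle$ and each owned by Al (who has the classical input $x$) or by Bob (who has the classical input $y$); there is no public coin and no prior entanglement, and inputs are never erased. In each of finitely many rounds one prescribed player applies to the qubits he holds a unitary that may depend on his input, and then sends a prescribed set of them to the other player. After the last round one player applies a final unitary to his qubits, makes a measurement determining the result, and sends the result to the other player. (Measurements during the rounds are carried out coherently, by unitaries on additional qubits; nothing is discarded.) The protocol computes $f$ with error $\varepsilon$ if on every input $(x,y)$ the result is $f(x,y)$ with probability at least $1-\varepsilon$. For a time $t$ and a distribution $\mu$ on $X\times Y$, let $A,B$ denote the registers held by Al and Bob at time $t$, for random inputs $(X,Y)$ distributed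 according to $\mu$. The information divulged to Bob is $I(B:X\mid Y,f(X,Y))$ and the information divulged to Al is $I(A:Y\mid X,f(X,Y))$, where $I(D:E\mid G)=S(DG)+S(EG)-S(G)-S(DEG)$ and $S$ is the von Neumann entropy. The privacy loss of the protocol is the supremum of these quantities over both players, all times $t$ (including the end, when both players hold the announced result) and all distributions $\mu$. The protocol is private if its privacy loss is $0$. -/

import Mathlib

namespace QPriv

/-! ### Entropy of finite-dimensional quantum states -/

/-- Von Neumann entropy `-∑ l * log₂ l`, the sum running over the multiset of all eigenvalues
(with multiplicity) of the density matrix `ρ`; `0 * log 0 = 0`. -/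
noncomputable def entropy {D : Type*} [Fintype D] [DecidableEq D] (ρ : Matrix D D ℂ) : ℝ :=
  -(ρ.charpoly.roots.map fun l => l.re * Real.logb 2 l.re).sum

/-- Conditional mutual information `I(D : E | G) = S(DG) + S(EG) - S(G) - S(DEG)`
of a state on three registers `D`, `E`, `G`; the marginals are partial traces. -/
noncomputable def condMutualInfo {D E G : Type*} [Fintype D] [DecidableEq D]
    [Fintype E] [DecidableEq E] [Fintype G] [DecidableEq G]
    (ρ : Matrix (D × E × G) (D × E × G) ℂ) : ℝ :=
  entropy (Matrix.of fun (a b : D × G) => ∑ e, ρ (a.1, e, a.2) (b.1, e, b.2))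
    + entropy (Matrix.of fun (a b : E × G) => ∑ d, ρ (d, a) (d, b))
    - entropy (Matrix.of fun (a b : G) => ∑ d, ∑ e, ρ (d, e, a) (d, e, b))
    - entropy ρ

/-- The state of the registers `D` (quantum), `E`, `G` (classical inputs) and `F` (classical, the
function value), when the inputs have distribution `μ` and the register `D` is in the state
`σ e g` on inputs `e, g`. -/
noncomputable def jointState {D E G Z : Type*} [DecidableEq E] [DecidableEq G] [DecidableEq Z]
    (μ : E → G → ℝ) (F : E → G → Z) (σ : E → G → Matrix D D ℂ) :
    Matrix (D × E × (G × Z)) (D × E × (G × Z)) ℂ :=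
  Matrix.of fun a b =>
    if a.2 = b.2 ∧ a.2.2.2 = F a.2.1 a.2.2.1 then
      (μ a.2.1 a.2.2.1 : ℂ) * σ a.2.1 a.2.2.1 a.1 b.1
    else 0

/-! ### Operators on sets of qubits -/

/-- `U ⊗ id`: the operator `U` applied to the qubits in `s`, the identity on the other qubits. -/
def applyOn {n : ℕ} (s : Fin n → Prop) [DecidablePred s]
    (U : Matrix ({i // s i} → Bool) ({i // s i} → Bool) ℂ) :
    Matrix (Fin n → Bool) (Fin n → Bool) ℂ :=
  Matrix.of fun a b =>
    if ∀ i, ¬ s i → a i = b i then U (fun i => a i) (fun i => b i) else 0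

/-- The reduced state on the qubits in `s` of the (possibly unnormalised) pure state `ψ`: the
partial trace of `|ψ⟩⟨ψ|` over the other qubits. -/
noncomputable def reduced {n : ℕ} (s : Fin n → Prop) [DecidablePred s] (ψ : (Fin n → Bool) → ℂ) :
    Matrix ({i // s i} → Bool) ({i // s i} → Bool) ℂ :=
  Matrix.of fun a b => ∑ c : {i // ¬ s i} → Bool,
    ψ ((Equiv.piEquivPiSubtypeProd s fun _ => Bool).symm (a, c)) *
      star (ψ ((Equiv.piEquivPiSubtypeProd s fun _ => Bool).symm (b, c)))

/-! ### Two-party quantum protocols -/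

/-- The two players. -/
inductive Player where
  | al
  | bob
  deriving DecidableEq

/-- A quantum communication protocol (without public coin or prior entanglement) on inputs
`x : X` for Al and `y : Y` for Bob with results in `Z`.

There are `qubits` many qubits, all in the state `|0⟩` at the start, and `owner t i` is the player
who holds qubit `i` at time `t`. In round `t < rounds` player `turn t` applies to the qubits he
holds a unitary that may depend on his own input (inputs are classical and never erased; the
unitary on his qubits and input register is controlled by the latter), and then sends some of his
qubits to the other player. After the last round, player `turn rounds` applies one more unitary,
measures the result, and sends it to the other player.

All other measurements are carried out coherently (by a unitary on additional qubits):
the players never discard anything. -/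
structure QuantumProtocol (X Y Z : Type*) where
  qubits : ℕ
  rounds : ℕ
  turn : ℕ → Player
  owner : ℕ → Fin qubits → Player
  /-- Only the player whose turn it is can give away qubits. -/
  owner_succ : ∀ t < rounds, ∀ i, owner t i ≠ turn t → owner (t + 1) i = owner t i
  /-- Al's unitaries, used at the times `t` with `turn t = al`. -/
  opAl : (t : ℕ) → X → Matrix.unitaryGroup ({i // owner t i = Player.al} → Bool) ℂ
  /-- Bob's unitaries, used at the times `t` with `turn t = bob`. -/
  opBob : (t : ℕ) → Y → Matrix.unitaryGroup ({i // owner t i = Player.bob} → Bool) ℂ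
  /-- The result Al announces after the last round, if `turn rounds = al`,
  as a function of his input and of the standard basis state of his qubits. -/
  outAl : X → ({i // owner rounds i = Player.al} → Bool) → Z
  /-- The result Bob announces after the last round, if `turn rounds = bob`. -/
  outBob : Y → ({i // owner rounds i = Player.bob} → Bool) → Z

namespace QuantumProtocol

variable {X Y Z : Type*} (P : QuantumProtocol X Y Z)

/-- The configurations (standard basis states) of the qubits that player `p` holds at time `t`. -/
abbrev Reg (t : ℕ) (p : Player) : Type := {i // P.owner t i = p} → Bool

/-- The action of the player whose turn it is at time `t`, on the space of all qubits. -/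
def localOp (t : ℕ) (x : X) (y : Y) :
    Matrix (Fin P.qubits → Bool) (Fin P.qubits → Bool) ℂ :=
  match P.turn t with
  | Player.al => applyOn (fun i => P.owner t i = Player.al) (P.opAl t x).1
  | Player.bob => applyOn (fun i => P.owner t i = Player.bob) (P.opBob t y).1

/-- The joint state of all qubits on inputs `x, y` at time `t`, i.e. after `t` rounds
(sending qubits changes their owner, not the state). The states inside a round, between the
unitary and the sending, differ from `state x y t` only by a unitary on one player's own qubits, so
they give the same entropies of the players' registers. -/
def state (x : X) (y : Y) : ℕ → (Fin P.qubits → Bool) → ℂ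
  | 0 => Pi.single (fun _ => false) 1
  | t + 1 => (P.localOp t x y).mulVec (state x y t)

/-- The result that is announced if the measurement finds the qubits in basis state `c`. -/
def result (x : X) (y : Y) (c : Fin P.qubits → Bool) : Z :=
  match P.turn P.rounds with
  | Player.al => P.outAl x fun i => c i
  | Player.bob => P.outBob y fun i => c i

/-- The unnormalised state of all qubits after the final measurement had result `z`:
the projection onto the span of the basis states with result `z`. -/
def finalBranch [DecidableEq Z] (x : X) (y : Y) (z : Z) : (Fin P.qubits → Bool) → ℂ :=
  fun c => if P.result x y c = z then P.state x y (P.rounds + 1) c else 0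

/-- The probability of the result `z` on inputs `x, y`. -/
noncomputable def resultProb [DecidableEq Z] (x : X) (y : Y) (z : Z) : ℝ :=
  ∑ c, ‖P.finalBranch x y z c‖ ^ 2

/-- The protocol computes `f` with error `ε`: on all inputs the result is right with
probability at least `1 - ε`. -/
def Computes [DecidableEq Z] (f : X → Y → Z) (ε : ℝ) : Prop :=
  ∀ x y, 1 - ε ≤ P.resultProb x y (f x y)

/-- The state of player `p`'s qubits at time `t` on inputs `x, y`. -/
noncomputable def playerState (t : ℕ) (p : Player) (x : X) (y : Y) :
    Matrix (P.Reg t p) (P.Reg t p) ℂ :=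
  reduced (fun i => P.owner t i = p) (P.state x y t)

/-- The state of player `p`'s qubits and of his copy of the announced result at the very end. -/
noncomputable def finalPlayerState [DecidableEq Z] (p : Player) (x : X) (y : Y) :
    Matrix (P.Reg P.rounds p × Z) (P.Reg P.rounds p × Z) ℂ :=
  Matrix.of fun a b =>
    if a.2 = b.2 then
      reduced (fun i => P.owner P.rounds i = p) (P.finalBranch x y a.2) a.1 b.1
    else 0

variable [Fintype X] [DecidableEq X] [Fintype Y] [DecidableEq Y] [Fintype Z] [DecidableEq Z]

/-- Information divulged to player `p`, who holds a register `D` in state `σ x y` on inputs `x, y`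
with distribution `μ`: `I(D : Y | X, f(X,Y))` for Al and `I(D : X | Y, f(X,Y))` for Bob. -/
noncomputable def divulged {D : Type*} [Fintype D] [DecidableEq D] (f : X → Y → Z)
    (μ : X × Y → ℝ) (p : Player) (σ : X → Y → Matrix D D ℂ) : ℝ :=
  match p with
  | Player.al =>
      condMutualInfo (jointState (fun y x => μ (x, y)) (fun y x => f x y) fun y x => σ x y)
  | Player.bob => condMutualInfo (jointState (fun x y => μ (x, y)) f σ)

/-- The privacy loss of the protocol with respect to `f`: the supremum of the information divulged
over both players, all times (including the end) and all distributions on the inputs. -/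
noncomputable def privacyLoss (f : X → Y → Z) : EReal :=
  ⨆ μ ∈ stdSimplex ℝ (X × Y), ⨆ p : Player,
    (⨆ t ∈ Set.Iic P.rounds, (divulged f μ p (P.playerState t p) : EReal)) ⊔
      (divulged f μ p (P.finalPlayerState p) : EReal)

/-- A private protocol for `f` has privacy loss exactly `0`. -/
def IsPrivate (f : X → Y → Z) : Prop :=
  P.privacyLoss f = 0

end QuantumProtocol

end QPriv

/-! Necessity. For the uniform distribution on two inputs `(x, y)`, `(x', y)` with the same value,
the information divulged to Bob is `S((σ + σ')/2) - (S(σ) + S(σ'))/2`, where `σ`, `σ'` are his two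
states (`condMutualInfo_jointState_pair`). Strict concavity of the entropy
(`eq_of_entropy_midpoint_le`) turns zero loss into `σ = σ'`, at every time; symmetrically for Al.

The joint states are pure, so equal marginals for Bob mean that the joint states differ by an
operator on Al's qubits (`exists_applyOn_of_reduced_eq`). Suppose `f x y = f x' y` and `f x y = f x
y'`. The invariant `Rectangle` says that one operator `V` of Al realises `x → x'` for both of Bob's
inputs, and that an operator `W` of Bob takes `y` to `y'`. It survives each round because the player
who is not acting learns nothing and keeps his qubits. Hence the equality of the announcer's states
along one side of the rectangle passes to the opposite side, which ends at the fourth corner `(x',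
y')`. There the result has the same distribution as at a neighbouring corner, and `ε < 1/2` forces
the same value. A Boolean function with no rectangle having exactly one deviating value is an
exclusive-or.

Sufficiency. Al sends `fA x`; Bob could compute this bit from `y` and the value of `f` anyway. -/

namespace QPriv

open Matrix Polynomial

/-! ### Entropy -/

/-- The summand `-x * log₂ x` of the entropy. -/
noncomputable def entTerm (x : ℝ) : ℝ := -(x * Real.logb 2 x)

theorem entTerm_eq (x : ℝ) : entTerm x = Real.negMulLog x / Real.log 2 := by
  unfold entTerm Real.negMulLog Real.logb
  ring

@[simp] theorem entTerm_zero : entTerm 0 = 0 := by simp [entTerm]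

@[simp] theorem entTerm_one : entTerm 1 = 0 := by simp [entTerm]

theorem entTerm_half : entTerm (1 / 2) = 1 / 2 := by
  simp [entTerm, Real.logb_inv]

theorem entTerm_half_mul (x : ℝ) : entTerm (1 / 2 * x) = 1 / 2 * entTerm x + 1 / 2 * x := by
  rcases eq_or_ne x 0 with rfl | hx
  · simp
  · unfold entTerm
    rw [Real.logb_mul (by norm_num) hx]
    simp [Real.logb_inv]
    ring

theorem strictConcaveOn_entTerm : StrictConcaveOn ℝ (Set.Ici 0) entTerm := by
  have hl : (0 : ℝ) < Real.log 2 := Real.log_pos (by norm_num)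
  refine ⟨convex_Ici 0, fun x hx y hy hxy a b ha hb hab => ?_⟩
  have := Real.strictConcaveOn_negMulLog.2 hx hy hxy ha hb hab
  simp only [entTerm_eq, smul_eq_mul] at this ⊢
  rw [← mul_div_assoc, ← mul_div_assoc, ← add_div]
  gcongr

section Entropy

variable {D E G Z : Type*} [Fintype D] [DecidableEq D] [Fintype E] [DecidableEq E]
  [Fintype G] [DecidableEq G] [Fintype Z] [DecidableEq Z]

theorem entropy_eq_sum_roots (ρ : Matrix D D ℂ) :
    entropy ρ = (ρ.charpoly.roots.map fun l => entTerm l.re).sum := by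
  simp [entropy, entTerm]

theorem entropy_of_isHermitian {ρ : Matrix D D ℂ} (h : ρ.IsHermitian) :
    entropy ρ = ∑ i, entTerm (h.eigenvalues i) := by
  rw [entropy_eq_sum_roots, h.roots_charpoly_eq_eigenvalues, Multiset.map_map]
  rfl

theorem charpoly_blockDiagonal (M : E → Matrix D D ℂ) :
    (blockDiagonal M).charpoly = ∏ k, (M k).charpoly := by
  have : (blockDiagonal M).charmatrix = blockDiagonal fun k => (M k).charmatrix := by
    ext ⟨i, k⟩ ⟨j, l⟩ : 2
    by_cases hkl : k = l
    · subst hkl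
      by_cases hij : i = j
      · subst hij
        simp [blockDiagonal_apply]
      · simp [blockDiagonal_apply, hij]
    · simp [blockDiagonal_apply, hkl]
  rw [Matrix.charpoly, this, det_blockDiagonal]
  rfl

theorem entropy_blockDiagonal (M : E → Matrix D D ℂ) :
    entropy (blockDiagonal M) = ∑ k, entropy (M k) := by
  have h : (∏ k, (M k).charpoly) ≠ 0 :=
    Finset.prod_ne_zero_iff.2 fun k _ => (charpoly_monic _).ne_zero
  simp only [entropy_eq_sum_roots, charpoly_blockDiagonal, roots_prod _ _ h, Multiset.map_bind,
    Multiset.sum_bind]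
  rfl

theorem entropy_diagonal (d : E → ℂ) : entropy (diagonal d) = ∑ k, entTerm (d k).re := by
  have h : (∏ k, (X - C (d k))) ≠ 0 := Finset.prod_ne_zero_iff.2 fun k _ => X_sub_C_ne_zero _
  simp only [entropy_eq_sum_roots, charpoly_diagonal, roots_prod _ _ h, Multiset.map_bind,
    Multiset.sum_bind, roots_X_sub_C, Multiset.map_singleton, Multiset.sum_singleton]
  rfl

@[simp] theorem entropy_zero : entropy (0 : Matrix D D ℂ) = 0 := by
  rw [← diagonal_zero, entropy_diagonal]
  simp

theorem entropy_smul_single (c : ℝ) (d : D) :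
    entropy ((c : ℂ) • (single d d 1 : Matrix D D ℂ)) = entTerm c := by
  have : (c : ℂ) • (single d d 1 : Matrix D D ℂ) = diagonal (Pi.single d (c : ℂ)) := by
    rw [smul_single, diagonal_single]
    simp
  rw [this, entropy_diagonal, Finset.sum_eq_single d]
  · simp
  · intro b _ hb
    simp [hb]
  · simp

theorem entropy_half_smul {ρ : Matrix D D ℂ} (h : ρ.IsHermitian) (ht : ρ.trace = 1) :
    entropy ((1 / 2 : ℂ) • ρ) = 1 / 2 * entropy ρ + 1 / 2 := by
  have hs : entropy ((1 / 2 : ℂ) • ρ) = ∑ i, entTerm (1 / 2 * h.eigenvalues i) := by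
    -- Comparing characteristic polynomials gives the scaled spectrum as a multiset, so no ordering
    -- of eigenvalues has to be matched.
    have hd : ((1 / 2 : ℂ) • ρ).charpoly =
        (diagonal fun i => (((1 / 2 * h.eigenvalues i : ℝ)) : ℂ)).charpoly := by
      conv_lhs => rw [h.spectral_theorem, ← map_smul, Unitary.conjStarAlgAut_apply,
        charpoly_mul_comm, ← mul_assoc]
      simp only [Unitary.coe_star_mul_self, one_mul]
      congr 1
      ext i j
      by_cases hij : i = j
      · subst hij; simp
      · simp [hij]
    rw [entropy_eq_sum_roots, hd, ← entropy_eq_sum_roots, entropy_diagonal]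
    simp
  have h1 : ∑ i, h.eigenvalues i = 1 := by
    have := h.trace_eq_sum_eigenvalues
    rw [ht] at this
    exact Complex.ofReal_injective (by push_cast; exact this.symm)
  rw [hs, entropy_of_isHermitian h]
  simp only [entTerm_half_mul, Finset.sum_add_distrib, ← Finset.mul_sum, h1, mul_one]

/-- The registers other than `D` are classical, so each marginal is block diagonal, or diagonal once
`D` is traced out; unit trace leaves just the weights `μ` there. -/
theorem condMutualInfo_jointState (μ : E → G → ℝ) (F : E → G → Z) (σ : E → G → Matrix D D ℂ)
    (hσ : ∀ e g, (σ e g).trace = 1) :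
    condMutualInfo (jointState μ F σ) =
      ∑ k : G × Z, entropy (∑ e, if k.2 = F e k.1 then (μ e k.1 : ℂ) • σ e k.1 else 0)
      + ∑ k : E × (G × Z), entTerm (if k.2.2 = F k.1 k.2.1 then μ k.1 k.2.1 else 0)
      - ∑ k : G × Z, entTerm (∑ e, if k.2 = F e k.1 then μ e k.1 else 0)
      - ∑ k : E × (G × Z),
          entropy (if k.2.2 = F k.1 k.2.1 then (μ k.1 k.2.1 : ℂ) • σ k.1 k.2.1 else 0) := by
  have htr : ∀ (c : ℂ) e g, ∑ d, c * σ e g d d = c := fun c e g => by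
    have h : ∑ d, σ e g d d = 1 := hσ e g
    rw [← Finset.mul_sum, h, mul_one]
  have hDG : entropy (Matrix.of fun (a b : D × (G × Z)) =>
      ∑ e, jointState μ F σ (a.1, e, a.2) (b.1, e, b.2)) =
      ∑ k : G × Z, entropy (∑ e, if k.2 = F e k.1 then (μ e k.1 : ℂ) • σ e k.1 else 0) := by
    rw [← entropy_blockDiagonal]
    congr 1
    ext ⟨d, k⟩ ⟨d', k'⟩
    simp only [jointState, of_apply, blockDiagonal_apply, Prod.mk.injEq, true_and]
    by_cases h : k = k'
    · subst h
      rw [if_pos rfl, Matrix.sum_apply]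
      refine Finset.sum_congr rfl fun e _ => ?_
      by_cases h1 : k.2 = F e k.1 <;> simp [h1]
    · simp [h]
  have hEG : entropy (Matrix.of fun (a b : E × (G × Z)) =>
      ∑ d, jointState μ F σ (d, a) (d, b)) =
      ∑ k : E × (G × Z), entTerm (if k.2.2 = F k.1 k.2.1 then μ k.1 k.2.1 else 0) := by
    have := entropy_diagonal fun k : E × (G × Z) =>
      ((if k.2.2 = F k.1 k.2.1 then μ k.1 k.2.1 else 0 : ℝ) : ℂ)
    simp only [Complex.ofReal_re] at this
    rw [← this]
    congr 1
    ext k k'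
    simp only [jointState, of_apply, diagonal_apply]
    by_cases h : k = k'
    · subst h
      by_cases h1 : k.2.2 = F k.1 k.2.1
      · simp only [h1, and_self, if_true, htr]
      · simp [h1]
    · simp [h]
  have hG : entropy (Matrix.of fun (a b : G × Z) =>
      ∑ d, ∑ e, jointState μ F σ (d, e, a) (d, e, b)) =
      ∑ k : G × Z, entTerm (∑ e, if k.2 = F e k.1 then μ e k.1 else 0) := by
    have := entropy_diagonal fun k : G × Z =>
      ((∑ e, if k.2 = F e k.1 then μ e k.1 else 0 : ℝ) : ℂ)
    simp only [Complex.ofReal_re] at this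
    rw [← this]
    congr 1
    ext k k'
    simp only [jointState, of_apply, diagonal_apply, Prod.mk.injEq, true_and]
    by_cases h : k = k'
    · subst h
      rw [if_pos rfl, Finset.sum_comm]
      push_cast
      refine Finset.sum_congr rfl fun e _ => ?_
      by_cases h1 : k.2 = F e k.1
      · simp only [h1, and_self, if_true, htr]
      · simp [h1]
    · simp [h]
  have hDEG : entropy (jointState μ F σ) = ∑ k : E × (G × Z),
      entropy (if k.2.2 = F k.1 k.2.1 then (μ k.1 k.2.1 : ℂ) • σ k.1 k.2.1 else 0) := by
    rw [← entropy_blockDiagonal]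
    congr 1
    ext ⟨d, k⟩ ⟨d', k'⟩
    simp only [jointState, of_apply, blockDiagonal_apply]
    by_cases h : k = k'
    · subst h
      by_cases h1 : k.2.2 = F k.1 k.2.1 <;> simp [h1]
    · simp [h]
  rw [condMutualInfo, hDG, hEG, hG, hDEG]

/-- Nothing is divulged by a basis state determined by one's own input and the function value. -/
theorem condMutualInfo_jointState_single (μ : E → G → ℝ) (F : E → G → Z) (h : G → Z → D) :
    condMutualInfo (jointState μ F fun e g => single (h g (F e g)) (h g (F e g)) 1) = 0 := by
  rw [condMutualInfo_jointState _ _ _ fun e g => by simp]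
  -- Once the value is fixed, the basis state no longer depends on `e`, so averaging over `e` only
  -- adds up weights.
  have h1 : ∀ k : G × Z, (∑ e, if k.2 = F e k.1 then
      (μ e k.1 : ℂ) • (single (h k.1 (F e k.1)) (h k.1 (F e k.1)) 1 : Matrix D D ℂ) else 0) =
      ((∑ e, if k.2 = F e k.1 then μ e k.1 else 0 : ℝ) : ℂ) • single (h k.1 k.2) (h k.1 k.2) 1 := by
    intro k
    push_cast
    rw [Finset.sum_smul]
    refine Finset.sum_congr rfl fun e _ => ?_
    split_ifs with hk
    · rw [hk]
    · simp
  have h2 : ∀ k : E × (G × Z), entropy (if k.2.2 = F k.1 k.2.1 then (μ k.1 k.2.1 : ℂ) •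
      (single (h k.2.1 (F k.1 k.2.1)) (h k.2.1 (F k.1 k.2.1)) 1 : Matrix D D ℂ) else 0) =
      entTerm (if k.2.2 = F k.1 k.2.1 then μ k.1 k.2.1 else 0) := by
    intro k
    split_ifs
    · exact entropy_smul_single _ _
    · simp
  simp only [h1, h2, entropy_smul_single]
  ring

/-- The information divulged by a register when there are two equally likely inputs. -/
theorem condMutualInfo_jointState_pair (F : E → G → Z) (σ : E → G → Matrix D D ℂ)
    (hσ : ∀ e g, (σ e g).trace = 1) (hH : ∀ e g, (σ e g).IsHermitian) {e₀ e₁ : E} (he : e₀ ≠ e₁)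
    (g₀ : G) (hF : F e₀ g₀ = F e₁ g₀) (μ : E → G → ℝ)
    (hμ : ∀ e g, μ e g = if g = g₀ ∧ (e = e₀ ∨ e = e₁) then 1 / 2 else 0) :
    condMutualInfo (jointState μ F σ) =
      entropy ((1 / 2 : ℂ) • σ e₀ g₀ + (1 / 2 : ℂ) • σ e₁ g₀)
        - 1 / 2 * (entropy (σ e₀ g₀) + entropy (σ e₁ g₀)) := by
  rw [condMutualInfo_jointState _ _ _ hσ]
  have h1 : ∑ k : G × Z, entropy (∑ e, if k.2 = F e k.1 then (μ e k.1 : ℂ) • σ e k.1 else 0) =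
      entropy ((1 / 2 : ℂ) • σ e₀ g₀ + (1 / 2 : ℂ) • σ e₁ g₀) := by
    rw [Finset.sum_eq_single (g₀, F e₀ g₀)]
    · rw [Fintype.sum_eq_add e₀ e₁ he]
      · simp [hμ, hF]
      · rintro e ⟨h0, h1⟩
        simp [hμ, h0, h1]
    · rintro ⟨g, z⟩ _ hk
      rw [Finset.sum_eq_zero, entropy_zero]
      intro e _
      simp only [hμ]
      split_ifs with hz hg
      · obtain ⟨rfl, rfl | rfl⟩ := hg
        · exact absurd (by rw [hz]) hk
        · exact absurd (by rw [hz, hF]) hk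
      · simp
      · rfl
    · simp
  -- By `hF` both inputs give the same label `(g₀, F e₀ g₀)`, so the weights are only `0` and `1`.
  have h3 : ∑ k : G × Z, entTerm (∑ e, if k.2 = F e k.1 then μ e k.1 else 0) = 0 := by
    refine Finset.sum_eq_zero fun k _ => ?_
    obtain ⟨g, z⟩ := k
    rw [Fintype.sum_eq_add e₀ e₁ he]
    · simp only [hμ, true_or, or_true, and_true]
      by_cases hg : g = g₀
      · subst hg
        by_cases hz : z = F e₁ g 
        · simp [hz, hF]
          norm_num
        · simp [hz, hF]
      · simp [hg]
    · rintro e ⟨h0, h1⟩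
      simp [hμ, h0, h1]
  have hsum : ∀ φ : E → G → Z → ℝ, (∀ e g z, ¬ (g = g₀ ∧ (e = e₀ ∨ e = e₁)) → φ e g z = 0) →
      (∀ e g z, z ≠ F e g → φ e g z = 0) →
      ∑ k : E × (G × Z), φ k.1 k.2.1 k.2.2 = φ e₀ g₀ (F e₀ g₀) + φ e₁ g₀ (F e₀ g₀) := by
    intro φ hφ hz
    rw [Fintype.sum_prod_type, Fintype.sum_eq_add e₀ e₁ he]
    · congr 1
      · rw [Finset.sum_eq_single (g₀, F e₀ g₀)]
        · rintro ⟨g, z⟩ _ hk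
          by_cases hg : g = g₀
          · subst hg
            exact hz _ _ _ fun h => hk (Prod.ext rfl h)
          · exact hφ _ _ _ fun h => hg h.1
        · simp
      · rw [Finset.sum_eq_single (g₀, F e₀ g₀)]
        · rintro ⟨g, z⟩ _ hk
          by_cases hg : g = g₀
          · subst hg
            exact hz _ _ _ fun h => hk (Prod.ext rfl (h.trans hF.symm))
          · exact hφ _ _ _ fun h => hg h.1
        · simp
    · rintro e ⟨h0, h1⟩
      exact Finset.sum_eq_zero fun k _ => hφ _ _ _ fun h => h.2.elim h0 h1
  have h2 := hsum (fun e g z => entTerm (if z = F e g then μ e g else 0))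
    (fun e g z h => by simp [hμ, h]) (fun e g z h => by simp [h])
  have h4 := hsum (fun e g z => entropy (if z = F e g then (μ e g : ℂ) • σ e g else 0))
    (fun e g z h => by simp [hμ, h]) (fun e g z h => by simp [h])
  -- The two extra halves cancel the two terms `entTerm (1 / 2)` coming from `h2`.
  have half : ∀ e, entropy (((1 / 2 : ℝ) : ℂ) • σ e g₀) = 1 / 2 * entropy (σ e g₀) + 1 / 2 := by
    intro e
    rw [← entropy_half_smul (hH e g₀) (hσ e g₀)]
    norm_num
  rw [h1, h3]
  simp only [] at h2 h4
  rw [h2, h4]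
  simp only [hμ, ← hF, if_true, true_or, or_true, and_true, entTerm_half, half]
  ring

end Entropy

end QPriv
namespace QPriv

open Matrix
open scoped ComplexOrder

/-! ### Strict concavity of the entropy -/

section Concavity

variable {D : Type*} [Fintype D] [DecidableEq D]

theorem posSemidef_apply_re_nonneg {D : Type*} {A : Matrix D D ℂ} (hA : A.PosSemidef) (k : D) :
    0 ≤ (A k k).re :=
  (Complex.le_def.1 (hA.diag_nonneg (i := k))).1

theorem entropy_unitary_conj (U : unitaryGroup D ℂ) (A : Matrix D D ℂ) :
    entropy (star (U : Matrix D D ℂ) * A * (U : Matrix D D ℂ)) = entropy A := by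
  have hUU : (U : Matrix D D ℂ) * star (U : Matrix D D ℂ) = 1 := Unitary.coe_mul_star_self _
  unfold entropy
  rw [charpoly_mul_comm, ← mul_assoc, hUU, one_mul]

/-- The entropy is at most that of the diagonal, with equality only for diagonal matrices. -/
theorem entropy_le_sum_diag {A : Matrix D D ℂ} (hA : A.PosSemidef) :
    entropy A ≤ ∑ k, entTerm (A k k).re ∧
      (∑ k, entTerm (A k k).re ≤ entropy A → A = diagonal fun k => A k k) := by
  set l := hA.isHermitian.eigenvalues with hl
  set U : Matrix D D ℂ := hA.isHermitian.eigenvectorUnitary.1 with hU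
  have hUU : U * star U = 1 := Unitary.coe_mul_star_self _
  have hUU' : star U * U = 1 := Unitary.coe_star_mul_self _
  have hAU : A = U * diagonal (fun i => (l i : ℂ)) * star U := by
    conv_lhs => rw [hA.isHermitian.spectral_theorem, Unitary.conjStarAlgAut_apply]
    rfl
  -- These weights are doubly stochastic and carry the spectrum to the diagonal: Jensen uses the row
  -- sums, and the column sums recover the entropy.
  set w : D → D → ℝ := fun k i => ‖U k i‖ ^ 2 with hw
  have hsq : ∀ z : ℂ, z * star z = ((‖z‖ ^ 2 : ℝ) : ℂ) := by
    intro z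
    rw [Complex.star_def, Complex.mul_conj, Complex.normSq_eq_norm_sq]
  have hw0 : ∀ k i, 0 ≤ w k i := fun k i => by positivity
  have hrow : ∀ k, ∑ i, w k i = 1 := by
    intro k
    have := congrFun (congrFun hUU k) k
    simp only [mul_apply, star_apply, hsq, one_apply_eq] at this
    exact_mod_cast this
  have hcol : ∀ i, ∑ k, w k i = 1 := by
    intro i
    have := congrFun (congrFun hUU' i) i
    simp only [mul_apply, star_apply, mul_comm (star _), hsq, one_apply_eq] at this
    exact_mod_cast this
  have hdiag : ∀ k, (A k k).re = ∑ i, w k i • l i := by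
    intro k
    have : A k k = ((∑ i, w k i • l i : ℝ) : ℂ) := by
      conv_lhs => rw [hAU]
      rw [mul_apply]
      push_cast
      refine Finset.sum_congr rfl fun i _ => ?_
      rw [mul_diagonal, star_apply, mul_right_comm, hsq]
      simp [hw]
    rw [this, Complex.ofReal_re]
  have hl0 : ∀ i, l i ∈ Set.Ici (0 : ℝ) := fun i => hA.eigenvalues_nonneg i
  have hterm : ∀ k, ∑ i, w k i • entTerm (l i) ≤ entTerm (A k k).re := by
    intro k
    rw [hdiag]
    exact strictConcaveOn_entTerm.concaveOn.le_map_sum (fun i _ => hw0 k i) (hrow k)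
      fun i _ => hl0 i
  have hent : entropy A = ∑ k, ∑ i, w k i • entTerm (l i) := by
    rw [entropy_of_isHermitian hA.isHermitian, Finset.sum_comm]
    simp only [smul_eq_mul, ← Finset.sum_mul, hcol, one_mul, ← hl]
  refine ⟨hent ▸ Finset.sum_le_sum fun k _ => hterm k, fun h => ?_⟩
  have heq : ∀ k, ∑ i, w k i • entTerm (l i) = entTerm (A k k).re := fun k =>
    (Finset.sum_eq_sum_iff_of_le fun k _ => hterm k).1
      (le_antisymm (Finset.sum_le_sum fun k _ => hterm k) (hent ▸ h)) k (Finset.mem_univ k)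
  -- Equality in strict Jensen: each eigenvalue with nonzero weight in row `k` equals the diagonal
  -- entry. As a matrix identity, this diagonalises `A` in the given basis.
  have hev : ∀ k i, U k i * l i = (A k k).re * U k i := by
    intro k i
    by_cases hki : U k i = 0
    · simp [hki]
    · have := (strictConcaveOn_entTerm.map_sum_eq_iff' (fun i _ => hw0 k i) (hrow k)
        fun i _ => hl0 i).1 (by rw [← hdiag, heq]) i (Finset.mem_univ i) (by simp [hw, hki])
      rw [this, ← hdiag, mul_comm]
  have hA' : A = diagonal fun k => ((A k k).re : ℂ) := by
    have : U * diagonal (fun i => (l i : ℂ)) = (diagonal fun k => ((A k k).re : ℂ)) * U := by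
      ext k i
      rw [mul_diagonal, diagonal_mul, hev]
    rw [this, mul_assoc, hUU, mul_one] at hAU
    exact hAU
  ext i j
  by_cases hij : i = j
  · subst hij
    simp
  · rw [hA']
    simp [hij]

/-- In an eigenbasis of the midpoint, its entropy is that of the averaged diagonals. This is at
least the average of the two diagonal entropies, which in turn is at least the average of the
entropies. The hypothesis forces equality throughout: both matrices are diagonal there, with the
same diagonal. -/
theorem eq_of_entropy_midpoint_le {A B : Matrix D D ℂ} (hA : A.PosSemidef) (hB : B.PosSemidef)
    (h : entropy ((1 / 2 : ℂ) • A + (1 / 2 : ℂ) • B) ≤ 1 / 2 * (entropy A + entropy B)) :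
    A = B := by
  set M := (1 / 2 : ℂ) • A + (1 / 2 : ℂ) • B with hM
  have hMH : M.IsHermitian := by
    have h2 : star (1 / 2 : ℂ) = 1 / 2 := by simp
    rw [hM, IsHermitian, conjTranspose_add, conjTranspose_smul, conjTranspose_smul, h2,
      hA.isHermitian.eq, hB.isHermitian.eq]
  set U := hMH.eigenvectorUnitary
  have hUU : (U : Matrix D D ℂ) * star (U : Matrix D D ℂ) = 1 := Unitary.coe_mul_star_self _
  set A' := star (U : Matrix D D ℂ) * A * (U : Matrix D D ℂ) with hA'
  set B' := star (U : Matrix D D ℂ) * B * (U : Matrix D D ℂ) with hB'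
  have pA : A'.PosSemidef := hA.conjTranspose_mul_mul_same _
  have pB : B'.PosSemidef := hB.conjTranspose_mul_mul_same _
  have hMd : (1 / 2 : ℂ) • A' + (1 / 2 : ℂ) • B' =
      diagonal fun i => (hMH.eigenvalues i : ℂ) := by
    have h1 : (1 / 2 : ℂ) • A' + (1 / 2 : ℂ) • B' = star (U : Matrix D D ℂ) * M * (U : Matrix D D ℂ) := by
      simp only [hM, hA', hB', mul_add, add_mul, mul_smul_comm, smul_mul_assoc]
    rw [h1]
    conv_lhs => rw [hMH.spectral_theorem, Unitary.conjStarAlgAut_apply]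
    simp only [mul_assoc]
    rw [Unitary.coe_star_mul_self, mul_one, ← mul_assoc, Unitary.coe_star_mul_self, one_mul]
    rfl
  have hev : ∀ k, hMH.eigenvalues k = (1 / 2 : ℝ) • (A' k k).re + (1 / 2 : ℝ) • (B' k k).re := by
    intro k
    have := congrArg Complex.re (congrFun (congrFun hMd k) k)
    simp at this
    simp [← this]
  have hEM : entropy M = ∑ k, entTerm ((1 / 2 : ℝ) • (A' k k).re + (1 / 2 : ℝ) • (B' k k).re) := by
    rw [entropy_of_isHermitian hMH]
    simp only [hev]
  obtain ⟨a1, a2⟩ := entropy_le_sum_diag pA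
  obtain ⟨b1, b2⟩ := entropy_le_sum_diag pB
  have eA : entropy A' = entropy A := entropy_unitary_conj U A
  have eB : entropy B' = entropy B := entropy_unitary_conj U B
  rw [eA] at a1 a2
  rw [eB] at b1 b2
  have hconc : ∀ k, (1 / 2 : ℝ) * entTerm (A' k k).re + (1 / 2 : ℝ) * entTerm (B' k k).re ≤
      entTerm ((1 / 2 : ℝ) • (A' k k).re + (1 / 2 : ℝ) • (B' k k).re) := fun k =>
    strictConcaveOn_entTerm.concaveOn.2 (posSemidef_apply_re_nonneg pA k)
      (posSemidef_apply_re_nonneg pB k) (by norm_num) (by norm_num) (by norm_num)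
  have hsum := Finset.sum_le_sum fun k (_ : k ∈ Finset.univ) => hconc k
  have hsplit : ∑ k, ((1 / 2 : ℝ) * entTerm (A' k k).re + (1 / 2 : ℝ) * entTerm (B' k k).re) =
      1 / 2 * ∑ k, entTerm (A' k k).re + 1 / 2 * ∑ k, entTerm (B' k k).re := by
    rw [Finset.sum_add_distrib, ← Finset.mul_sum, ← Finset.mul_sum]
  rw [← hEM] at hsum
  have heq : ∀ k, (A' k k).re = (B' k k).re := by
    intro k
    by_contra hne
    have hlt := strictConcaveOn_entTerm.2 (posSemidef_apply_re_nonneg pA k)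
      (posSemidef_apply_re_nonneg pB k) hne (by norm_num : (0 : ℝ) < 1 / 2)
      (by norm_num : (0 : ℝ) < 1 / 2) (by norm_num)
    have := Finset.sum_lt_sum (fun k (_ : k ∈ Finset.univ) => hconc k)
      ⟨k, Finset.mem_univ k, hlt⟩
    rw [← hEM] at this
    linarith
  have dA := a2 (by linarith)
  have dB := b2 (by linarith)
  have hAB : A' = B' := by
    rw [dA, dB]
    congr 1
    funext k
    have hA0 := (Complex.le_def.1 (pA.diag_nonneg (i := k))).2
    have hB0 := (Complex.le_def.1 (pB.diag_nonneg (i := k))).2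
    exact Complex.ext (heq k) (hA0.symm.trans hB0)
  have back : ∀ C : Matrix D D ℂ,
      (U : Matrix D D ℂ) * (star (U : Matrix D D ℂ) * C * (U : Matrix D D ℂ)) * star (U : Matrix D D ℂ) = C := by
    intro C
    simp only [mul_assoc]
    rw [hUU, mul_one, ← mul_assoc, hUU, one_mul]
  rw [← back A, ← back B, ← hA', ← hB', hAB]

end Concavity

end QPriv
namespace QPriv

open Matrix
open scoped ComplexOrder

/-! ### Operators on complementary sets of qubits -/

section Local

/-- Equality of Gram matrices gives a linear relation between the factors. -/
theorem exists_eq_mul_of_gram_eq {S C : Type*} [Fintype S] [DecidableEq S] [Fintype C]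
    [DecidableEq C] (M N : Matrix S C ℂ) (h : M * Mᴴ = N * Nᴴ) : ∃ K : Matrix C C ℂ, N = M * K := by
  -- `Mᴴ` has the same kernel as `M * Mᴴ`. So `Nᴴ` factors through the range of `Mᴴ`, and any linear
  -- extension of the factor will do: unitarity is not needed later.
  have hk : LinearMap.ker Mᴴ.mulVecLin ≤ LinearMap.ker Nᴴ.mulVecLin := by
    intro v hv
    rw [LinearMap.mem_ker, mulVecLin_apply] at hv ⊢
    rwa [← self_mul_conjTranspose_mulVec_eq_zero, ← h, self_mul_conjTranspose_mulVec_eq_zero]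
  obtain ⟨g, hg⟩ := LinearMap.exists_extend (p := LinearMap.range Mᴴ.mulVecLin)
    ((LinearMap.ker Mᴴ.mulVecLin).liftQ Nᴴ.mulVecLin hk ∘ₗ
      (Mᴴ.mulVecLin.quotKerEquivRange.symm : _ →ₗ[ℂ] _))
  have hg' : ∀ v, g (Mᴴ *ᵥ v) = Nᴴ *ᵥ v := by
    intro v
    have h1 := LinearMap.congr_fun hg ⟨Mᴴ.mulVecLin v, LinearMap.mem_range_self _ v⟩
    have h2 : Mᴴ.mulVecLin.quotKerEquivRange.symm ⟨Mᴴ.mulVecLin v, LinearMap.mem_range_self _ v⟩ =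
        (LinearMap.ker Mᴴ.mulVecLin).mkQ v :=
      LinearMap.quotKerEquivRange_symm_apply_image _ _ _
    have h3 : g (Mᴴ *ᵥ v) = (LinearMap.ker Mᴴ.mulVecLin).liftQ Nᴴ.mulVecLin hk
        (Mᴴ.mulVecLin.quotKerEquivRange.symm
          ⟨Mᴴ.mulVecLin v, LinearMap.mem_range_self _ v⟩) := h1
    rw [h3, h2]
    rfl
  have hN : Nᴴ = LinearMap.toMatrix' g * Mᴴ := by
    apply Matrix.mulVec_injective
    funext v
    rw [← mulVec_mulVec, LinearMap.toMatrix'_mulVec, hg']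
  refine ⟨(LinearMap.toMatrix' g)ᴴ, ?_⟩
  have := congrArg conjTranspose hN
  simpa using this

variable {n : ℕ} (s t : Fin n → Prop) [DecidablePred s] [DecidablePred t]

/-- The configuration given by `a` on `s` and by `c` off `s`. -/
def glue (a : {i // s i} → Bool) (c : {i // ¬ s i} → Bool) : Fin n → Bool :=
  (Equiv.piEquivPiSubtypeProd s fun _ => Bool).symm (a, c)

variable {s}

theorem glue_of_pos (a : {i // s i} → Bool) (c : {i // ¬ s i} → Bool) {i : Fin n} (h : s i) :
    glue s a c i = a ⟨i, h⟩ := by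
  simp [glue, h]

theorem glue_of_neg (a : {i // s i} → Bool) (c : {i // ¬ s i} → Bool) {i : Fin n} (h : ¬ s i) :
    glue s a c i = c ⟨i, h⟩ := by
  simp [glue, h]

theorem glue_restrict (a : {i // s i} → Bool) (c : {i // ¬ s i} → Bool) :
    (fun i : {i // s i} => glue s a c i) = a :=
  funext fun i => glue_of_pos a c i.2

theorem glue_restrict_not (a : {i // s i} → Bool) (c : {i // ¬ s i} → Bool) :
    (fun i : {i // ¬ s i} => glue s a c i) = c :=
  funext fun i => glue_of_neg a c i.2

theorem glue_self (b : Fin n → Bool) : glue s (fun i => b i) (fun i => b i) = b := by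
  funext i
  by_cases h : s i
  · rw [glue_of_pos _ _ h]
  · rw [glue_of_neg _ _ h]

theorem sum_glue {M : Type*} [AddCommMonoid M] (φ : (Fin n → Bool) → M) :
    ∑ b, φ b = ∑ a, ∑ c, φ (glue s a c) := by
  rw [← Fintype.sum_prod_type']
  exact (Equiv.sum_comp (Equiv.piEquivPiSubtypeProd s fun _ => Bool).symm φ).symm

variable (s)

/-- A vector as a matrix, with rows for the qubits in `s` and columns for the other qubits. -/
def asMatrix (ψ : (Fin n → Bool) → ℂ) :
    Matrix ({i // s i} → Bool) ({i // ¬ s i} → Bool) ℂ :=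
  Matrix.of fun a c => ψ (glue s a c)

theorem asMatrix_injective : Function.Injective (asMatrix s) := by
  intro ψ φ h
  funext b
  have := congrFun (congrFun h fun i => b i) fun i => b i
  simpa only [asMatrix, of_apply, glue_self] using this

theorem reduced_eq (ψ : (Fin n → Bool) → ℂ) :
    reduced s ψ = asMatrix s ψ * (asMatrix s ψ)ᴴ := by
  ext a b
  simp [reduced, asMatrix, glue, mul_apply]

theorem reduced_posSemidef (ψ : (Fin n → Bool) → ℂ) : (reduced s ψ).PosSemidef := by
  rw [reduced_eq]
  exact posSemidef_self_mul_conjTranspose _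

theorem reduced_apply_self (ψ : (Fin n → Bool) → ℂ) (a : {i // s i} → Bool) :
    reduced s ψ a a = ((∑ c, ‖ψ (glue s a c)‖ ^ 2 : ℝ) : ℂ) := by
  simp only [reduced, of_apply, Complex.star_def, Complex.mul_conj, Complex.normSq_eq_norm_sq]
  push_cast
  rfl

theorem trace_reduced (ψ : (Fin n → Bool) → ℂ) :
    (reduced s ψ).trace = ((∑ b, ‖ψ b‖ ^ 2 : ℝ) : ℂ) := by
  simp only [trace, diag_apply, reduced_apply_self]
  rw [sum_glue (s := s)]
  push_cast
  rfl

theorem asMatrix_applyOn (U : Matrix ({i // s i} → Bool) ({i // s i} → Bool) ℂ)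
    (ψ : (Fin n → Bool) → ℂ) : asMatrix s (applyOn s U *ᵥ ψ) = U * asMatrix s ψ := by
  ext a c
  simp only [asMatrix, of_apply, mulVec, dotProduct, mul_apply]
  rw [sum_glue (s := s)]
  refine Finset.sum_congr rfl fun d _ => ?_
  rw [Finset.sum_eq_single c]
  · have : ∀ i, ¬ s i → glue s a c i = glue s d c i := fun i hi => by
      rw [glue_of_neg _ _ hi, glue_of_neg _ _ hi]
    simp only [applyOn, of_apply, if_pos this, glue_restrict]
  · intro c' _ hc
    have : ¬ ∀ i, ¬ s i → glue s a c i = glue s d c' i := fun h => hc <| by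
      funext i
      have := h i i.2
      rwa [glue_of_neg _ _ i.2, glue_of_neg _ _ i.2, eq_comm] at this
    simp only [applyOn, of_apply, if_neg this, zero_mul]
  · simp

theorem applyOn_one_mulVec (ψ : (Fin n → Bool) → ℂ) : applyOn s 1 *ᵥ ψ = ψ := by
  apply asMatrix_injective s
  rw [asMatrix_applyOn, Matrix.one_mul]

theorem reduced_applyOn (U : Matrix ({i // s i} → Bool) ({i // s i} → Bool) ℂ)
    (ψ : (Fin n → Bool) → ℂ) : reduced s (applyOn s U *ᵥ ψ) = U * reduced s ψ * Uᴴ := by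
  rw [reduced_eq, reduced_eq, asMatrix_applyOn, conjTranspose_mul]
  simp only [Matrix.mul_assoc]

/-- Operators on `s` multiply on the left and those off `s` on the right, so their commutation
becomes associativity. -/
theorem asMatrix_applyOn_not (V : Matrix ({i // ¬ s i} → Bool) ({i // ¬ s i} → Bool) ℂ)
    (ψ : (Fin n → Bool) → ℂ) :
    asMatrix s (applyOn (fun i => ¬ s i) V *ᵥ ψ) = asMatrix s ψ * Vᵀ := by
  ext a c
  simp only [asMatrix, of_apply, mulVec, dotProduct, mul_apply, transpose_apply]
  rw [sum_glue (s := s), Finset.sum_comm]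
  refine Finset.sum_congr rfl fun d _ => ?_
  rw [Finset.sum_eq_single a]
  · have : ∀ i, ¬ ¬ s i → glue s a c i = glue s a d i := fun i hi => by
      rw [glue_of_pos _ _ (not_not.1 hi), glue_of_pos _ _ (not_not.1 hi)]
    simp only [applyOn, of_apply, if_pos this, glue_restrict_not]
    ring
  · intro a' _ ha
    have : ¬ ∀ i, ¬ ¬ s i → glue s a c i = glue s a' d i := fun h => ha <| by
      funext i
      have := h i (not_not.2 i.2)
      rwa [glue_of_pos _ _ i.2, glue_of_pos _ _ i.2, eq_comm] at this
    simp only [applyOn, of_apply, if_neg this, zero_mul]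
  · simp

variable {s t}

/-- Operators on complementary sets of qubits commute. -/
theorem applyOn_comm (hst : ∀ i, t i ↔ ¬ s i)
    (U : Matrix ({i // s i} → Bool) ({i // s i} → Bool) ℂ)
    (V : Matrix ({i // t i} → Bool) ({i // t i} → Bool) ℂ) (ψ : (Fin n → Bool) → ℂ) :
    applyOn s U *ᵥ (applyOn t V *ᵥ ψ) = applyOn t V *ᵥ (applyOn s U *ᵥ ψ) := by
  obtain rfl : t = fun i => ¬ s i := funext fun i => propext (hst i)
  obtain rfl : ‹DecidablePred fun i => ¬ s i› = fun i => instDecidableNot :=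
    Subsingleton.elim _ _
  apply asMatrix_injective s
  simp only [asMatrix_applyOn, asMatrix_applyOn_not, Matrix.mul_assoc]

/-- Vectors with the same reduced state on `s` differ by an operator on the complement. -/
theorem exists_applyOn_of_reduced_eq (hst : ∀ i, t i ↔ ¬ s i) {ψ φ : (Fin n → Bool) → ℂ}
    (h : reduced s ψ = reduced s φ) : ∃ V, φ = applyOn t V *ᵥ ψ := by
  obtain rfl : t = fun i => ¬ s i := funext fun i => propext (hst i)
  obtain rfl : ‹DecidablePred fun i => ¬ s i› = fun i => instDecidableNot :=
    Subsingleton.elim _ _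
  rw [reduced_eq, reduced_eq] at h
  obtain ⟨K, hK⟩ := exists_eq_mul_of_gram_eq _ _ h
  refine ⟨Kᵀ, asMatrix_injective s ?_⟩
  rw [asMatrix_applyOn_not, transpose_transpose, hK]

/-- An operator on a set of qubits is an operator on every larger set of qubits. -/
theorem exists_applyOn_of_imp (hst : ∀ i, s i → t i)
    (U : Matrix ({i // s i} → Bool) ({i // s i} → Bool) ℂ) :
    ∃ V : Matrix ({i // t i} → Bool) ({i // t i} → Bool) ℂ, applyOn s U = applyOn t V := by
  refine ⟨Matrix.of fun a b => if ∀ i : {i // t i}, ¬ s i → a i = b i then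
    U (fun i => a ⟨i, hst i i.2⟩) (fun i => b ⟨i, hst i i.2⟩) else 0, ?_⟩
  ext a b
  simp only [applyOn, of_apply]
  by_cases h : ∀ i, ¬ s i → a i = b i
  · rw [if_pos h, if_pos fun i hi => h i fun hs => hi (hst i hs)]
    exact (if_pos fun (i : {i // t i}) hi => h i hi).symm
  · rw [if_neg h]
    split_ifs with h1 h2
    · exfalso
      refine h fun i hi => ?_
      by_cases ht : t i
      · exact h2 ⟨i, ht⟩ hi
      · exact h1 i ht
    · rfl
    · rfl

theorem sum_norm_sq_applyOn (U : unitaryGroup ({i // s i} → Bool) ℂ) (ψ : (Fin n → Bool) → ℂ) :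
    ∑ b, ‖(applyOn s U.1 *ᵥ ψ) b‖ ^ 2 = ∑ b, ‖ψ b‖ ^ 2 := by
  have h := trace_reduced s (applyOn s U.1 *ᵥ ψ)
  have hU : (U.1)ᴴ * U.1 = 1 := Unitary.coe_star_mul_self U
  rw [reduced_applyOn, trace_mul_comm, ← Matrix.mul_assoc, hU, Matrix.one_mul, trace_reduced] at h
  exact_mod_cast h.symm

/-- Four vectors, indexed by the inputs of the owners of the qubits in `s` and in `t`, are related
by one operator for each owner. -/
def Rectangle (s t : Fin n → Prop) [DecidablePred s] [DecidablePred t]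
    (ψ₀₀ ψ₀₁ ψ₁₀ ψ₁₁ : (Fin n → Bool) → ℂ) : Prop :=
  ∃ V W, ψ₁₀ = applyOn s V *ᵥ ψ₀₀ ∧ ψ₀₁ = applyOn t W *ᵥ ψ₀₀ ∧ ψ₁₁ = applyOn s V *ᵥ ψ₀₁

namespace Rectangle

variable {ψ₀₀ ψ₀₁ ψ₁₀ ψ₁₁ : (Fin n → Bool) → ℂ}

theorem refl (ψ : (Fin n → Bool) → ℂ) : Rectangle s t ψ ψ ψ ψ :=
  ⟨1, 1, by simp [applyOn_one_mulVec], by simp [applyOn_one_mulVec], by simp [applyOn_one_mulVec]⟩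

theorem symm (hst : ∀ i, t i ↔ ¬ s i) (h : Rectangle s t ψ₀₀ ψ₀₁ ψ₁₀ ψ₁₁) :
    Rectangle t s ψ₀₀ ψ₁₀ ψ₀₁ ψ₁₁ := by
  obtain ⟨V, W, rfl, rfl, rfl⟩ := h
  exact ⟨W, V, rfl, rfl, applyOn_comm hst _ _ _⟩

/-- The relation survives a round in which the owner of `s` applies unitaries and gives away
qubits, if the other owner learns nothing. -/
theorem step {s' t' : Fin n → Prop} [DecidablePred s'] [DecidablePred t']
    (hst : ∀ i, t i ↔ ¬ s i) (hst' : ∀ i, t' i ↔ ¬ s' i) (htt' : ∀ i, t i → t' i)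
    (h : Rectangle s t ψ₀₀ ψ₀₁ ψ₁₀ ψ₁₁) (U₀ U₁ : unitaryGroup ({i // s i} → Bool) ℂ)
    (hr : reduced t' (applyOn s U₀.1 *ᵥ ψ₀₀) = reduced t' (applyOn s U₁.1 *ᵥ ψ₁₀)) :
    Rectangle s' t' (applyOn s U₀.1 *ᵥ ψ₀₀) (applyOn s U₀.1 *ᵥ ψ₀₁) (applyOn s U₁.1 *ᵥ ψ₁₀)
      (applyOn s U₁.1 *ᵥ ψ₁₁) := by
  obtain ⟨V, W, rfl, rfl, rfl⟩ := h
  have hst'' : ∀ i, s' i ↔ ¬ t' i := fun i => by rw [hst', not_not]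
  -- The receiver's equal marginals supply the new operator on the sender's remaining qubits. The
  -- old `W` stays valid because the receiver keeps all his qubits.
  obtain ⟨V', hV'⟩ := exists_applyOn_of_reduced_eq hst'' hr
  obtain ⟨W', hW'⟩ := exists_applyOn_of_imp htt' W
  refine ⟨V', W', hV', ?_, ?_⟩
  · rw [applyOn_comm hst, hW']
  · calc applyOn s U₁.1 *ᵥ (applyOn s V *ᵥ (applyOn t W *ᵥ ψ₀₀))
        = applyOn t W *ᵥ (applyOn s U₁.1 *ᵥ (applyOn s V *ᵥ ψ₀₀)) := by
          rw [applyOn_comm hst, applyOn_comm hst]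
      _ = applyOn t' W' *ᵥ (applyOn s' V' *ᵥ (applyOn s U₀.1 *ᵥ ψ₀₀)) := by rw [hV', hW']
      _ = applyOn s' V' *ᵥ (applyOn t W *ᵥ (applyOn s U₀.1 *ᵥ ψ₀₀)) := by
          rw [hW', applyOn_comm hst']
      _ = applyOn s' V' *ᵥ (applyOn s U₀.1 *ᵥ (applyOn t W *ᵥ ψ₀₀)) := by
          rw [applyOn_comm hst]

/-- The same `V` acts on both vectors, so it conjugates equal reduced states to equal ones. -/
theorem reduced_eq (h : Rectangle s t ψ₀₀ ψ₀₁ ψ₁₀ ψ₁₁) (hr : reduced s ψ₀₀ = reduced s ψ₀₁) :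
    reduced s ψ₁₀ = reduced s ψ₁₁ := by
  obtain ⟨V, W, h1, -, h2⟩ := h
  rw [h1, h2, reduced_applyOn, reduced_applyOn, hr]

end Rectangle

end Local

end QPriv
namespace QPriv

open Matrix
open scoped ComplexOrder

namespace QuantumProtocol

/-! ### Private protocols compute only exclusive-ors -/

section Necessity

variable {X Y Z : Type*} (P : QuantumProtocol X Y Z)

theorem localOp_of_al {t : ℕ} (h : P.turn t = Player.al) (x : X) (y : Y) :
    P.localOp t x y = applyOn (fun i => P.owner t i = Player.al) (P.opAl t x).1 := by
  unfold localOp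
  rw [h]

theorem localOp_of_bob {t : ℕ} (h : P.turn t = Player.bob) (x : X) (y : Y) :
    P.localOp t x y = applyOn (fun i => P.owner t i = Player.bob) (P.opBob t y).1 := by
  unfold localOp
  rw [h]

theorem sum_norm_sq_state (x : X) (y : Y) (t : ℕ) : ∑ c, ‖P.state x y t c‖ ^ 2 = 1 := by
  induction t with
  | zero =>
    rw [Finset.sum_eq_single fun _ => false]
    · simp [state]
    · intro b _ hb
      simp [state, hb]
    · simp
  | succ t ih =>
    rw [state]
    cases h : P.turn t
    · rw [P.localOp_of_al h, sum_norm_sq_applyOn, ih]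
    · rw [P.localOp_of_bob h, sum_norm_sq_applyOn, ih]

theorem trace_playerState (t : ℕ) (p : Player) (x : X) (y : Y) :
    (P.playerState t p x y).trace = 1 := by
  rw [playerState, trace_reduced, sum_norm_sq_state, Complex.ofReal_one]

theorem playerState_posSemidef (t : ℕ) (p : Player) (x : X) (y : Y) :
    (P.playerState t p x y).PosSemidef :=
  reduced_posSemidef _ _

theorem owner_eq_bob_iff (t : ℕ) (i : Fin P.qubits) :
    P.owner t i = Player.bob ↔ ¬ P.owner t i = Player.al := by
  cases P.owner t i <;> simp

theorem owner_eq_al_iff (t : ℕ) (i : Fin P.qubits) :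
    P.owner t i = Player.al ↔ ¬ P.owner t i = Player.bob := by
  cases P.owner t i <;> simp

/-! ### Consequences of zero privacy loss -/

section Private

variable {P} [Fintype X] [DecidableEq X] [Fintype Y] [DecidableEq Y] [Fintype Z] [DecidableEq Z]
  {f : X → Y → Z}

theorem IsPrivate.divulged_nonpos (hP : P.IsPrivate f) {μ : X × Y → ℝ}
    (hμ : μ ∈ stdSimplex ℝ (X × Y)) (p : Player) {t : ℕ} (ht : t ≤ P.rounds) :
    divulged f μ p (P.playerState t p) ≤ 0 := by
  have h : (divulged f μ p (P.playerState t p) : EReal) ≤ P.privacyLoss f :=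
    le_trans (le_trans (le_iSup₂ (f := fun t (_ : t ∈ Set.Iic P.rounds) =>
      (divulged f μ p (P.playerState t p) : EReal)) t ht) le_sup_left)
      (le_iSup₂_of_le μ hμ (le_iSup_of_le p le_rfl))
  rw [hP] at h
  exact_mod_cast h

/-- The uniform distribution on two inputs. -/
theorem uniform_pair_mem_stdSimplex {I : Type*} [Fintype I] [DecidableEq I] {a b : I}
    (hab : a ≠ b) : (fun i => if i = a ∨ i = b then (1 / 2 : ℝ) else 0) ∈ stdSimplex ℝ I := by
  refine ⟨fun i => by dsimp only; split_ifs <;> norm_num, ?_⟩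
  rw [Fintype.sum_eq_add a b hab]
  · simp
    norm_num
  · rintro i ⟨ha, hb⟩
    simp [ha, hb]

theorem IsPrivate.playerState_bob_eq (hP : P.IsPrivate f) {t : ℕ} (ht : t ≤ P.rounds)
    {x x' : X} {y : Y} (hf : f x y = f x' y) :
    P.playerState t Player.bob x y = P.playerState t Player.bob x' y := by
  rcases eq_or_ne x x' with rfl | hx
  · rfl
  have h := hP.divulged_nonpos (uniform_pair_mem_stdSimplex (a := (x, y)) (b := (x', y))
    (by simpa using hx)) Player.bob ht
  rw [divulged, condMutualInfo_jointState_pair f (P.playerState t Player.bob)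
    (P.trace_playerState t _) (fun _ _ => (P.playerState_posSemidef t _ _ _).isHermitian) hx y hf]
    at h
  · exact eq_of_entropy_midpoint_le (P.playerState_posSemidef t _ _ _)
      (P.playerState_posSemidef t _ _ _) (by linarith)
  · intro e g
    simp only [Prod.mk.injEq]
    congr 1
    apply propext
    tauto

theorem IsPrivate.playerState_al_eq (hP : P.IsPrivate f) {t : ℕ} (ht : t ≤ P.rounds)
    {x : X} {y y' : Y} (hf : f x y = f x y') :
    P.playerState t Player.al x y = P.playerState t Player.al x y' := by
  rcases eq_or_ne y y' with rfl | hy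
  · rfl
  have h := hP.divulged_nonpos (uniform_pair_mem_stdSimplex (a := (x, y)) (b := (x, y'))
    (by simpa using hy)) Player.al ht
  rw [divulged, condMutualInfo_jointState_pair (fun y x => f x y)
    (fun y x => P.playerState t Player.al x y) (fun _ _ => P.trace_playerState t _ _ _)
    (fun _ _ => (P.playerState_posSemidef t _ _ _).isHermitian) hy x hf] at h
  · exact eq_of_entropy_midpoint_le (P.playerState_posSemidef t _ _ _)
      (P.playerState_posSemidef t _ _ _) (by linarith)
  · intro e g
    simp only [Prod.mk.injEq]
    congr 1
    apply propext
    tauto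

/-- In a private protocol, changing one input without changing the value acts on the state by an
operator of the player with that input, whatever the other input is. -/
theorem IsPrivate.rectangle (hP : P.IsPrivate f) {x x' : X} {y y' : Y} (hx : f x y = f x' y)
    (hy : f x y = f x y') {t : ℕ} (ht : t ≤ P.rounds) :
    Rectangle (fun i => P.owner t i = Player.al) (fun i => P.owner t i = Player.bob)
      (P.state x y t) (P.state x y' t) (P.state x' y t) (P.state x' y' t) := by
  induction t with
  -- The initial state does not depend on the inputs.
  | zero => exact Rectangle.refl _
  | succ t ih =>
    have ih := ih (by omega)
    have hb := hP.playerState_bob_eq ht hx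
    have ha := hP.playerState_al_eq ht hy
    simp only [playerState, state] at ha hb ⊢
    cases h : P.turn t
    · simp only [P.localOp_of_al h] at ha hb ⊢
      refine ih.step (P.owner_eq_bob_iff t) (P.owner_eq_bob_iff (t + 1)) (fun i hi => ?_) _ _ hb
      rw [P.owner_succ t ht i (by rw [hi, h]; simp), hi]
    -- When Bob acts, the same step applies to the transposed rectangle.
    · simp only [P.localOp_of_bob h] at ha hb ⊢
      refine ((ih.symm (P.owner_eq_bob_iff t)).step (P.owner_eq_al_iff t)
        (P.owner_eq_al_iff (t + 1)) (fun i hi => ?_) _ _ ha).symm (P.owner_eq_al_iff (t + 1))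
      rw [P.owner_succ t ht i (by rw [hi, h]; simp), hi]

end Private

/-! ### Distribution of the announced result -/

variable [DecidableEq Z]

theorem sum_norm_sq_eq_sum_reduced {n : ℕ} (s : Fin n → Prop) [DecidablePred s]
    (ψ : (Fin n → Bool) → ℂ) (q : ({i // s i} → Bool) → Prop) [DecidablePred q] :
    ∑ c, ‖if q (fun i => c i) then ψ c else 0‖ ^ 2 =
      ∑ a, if q a then (reduced s ψ a a).re else 0 := by
  rw [sum_glue (s := s)]
  refine Finset.sum_congr rfl fun a _ => ?_
  simp only [glue_restrict, reduced_apply_self, Complex.ofReal_re]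
  split_ifs <;> simp

/-- The other player's input enters only through the announcer's reduced state before his last
unitary. -/
theorem resultProb_of_al (h : P.turn P.rounds = Player.al) (x : X) (y : Y) (z : Z) :
    P.resultProb x y z = ∑ a, if P.outAl x a = z then
      (((P.opAl P.rounds x).1 * P.playerState P.rounds Player.al x y *
        (P.opAl P.rounds x).1ᴴ) a a).re else 0 := by
  have h1 : ∀ c, P.finalBranch x y z c = if P.outAl x (fun i => c i) = z then
      P.state x y (P.rounds + 1) c else 0 := by
    intro c
    unfold finalBranch result
    rw [h]
  simp only [resultProb, h1, playerState, ← reduced_applyOn]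
  rw [sum_norm_sq_eq_sum_reduced (fun i => P.owner P.rounds i = Player.al)
    (P.state x y (P.rounds + 1)) fun a => P.outAl x a = z, state, P.localOp_of_al h]

theorem resultProb_of_bob (h : P.turn P.rounds = Player.bob) (x : X) (y : Y) (z : Z) :
    P.resultProb x y z = ∑ a, if P.outBob y a = z then
      (((P.opBob P.rounds y).1 * P.playerState P.rounds Player.bob x y *
        (P.opBob P.rounds y).1ᴴ) a a).re else 0 := by
  have h1 : ∀ c, P.finalBranch x y z c = if P.outBob y (fun i => c i) = z then
      P.state x y (P.rounds + 1) c else 0 := by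
    intro c
    unfold finalBranch result
    rw [h]
  simp only [resultProb, h1, playerState, ← reduced_applyOn]
  rw [sum_norm_sq_eq_sum_reduced (fun i => P.owner P.rounds i = Player.bob)
    (P.state x y (P.rounds + 1)) fun a => P.outBob y a = z, state, P.localOp_of_bob h]

theorem resultProb_add_le_one (x : X) (y : Y) {z z' : Z} (h : z ≠ z') :
    P.resultProb x y z + P.resultProb x y z' ≤ 1 := by
  rw [resultProb, resultProb, ← Finset.sum_add_distrib, ← P.sum_norm_sq_state x y (P.rounds + 1)]
  refine Finset.sum_le_sum fun c _ => ?_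
  unfold finalBranch
  by_cases hz : P.result x y c = z
  · have : ¬ P.result x y c = z' := fun h' => h (hz.symm.trans h')
    simp [hz, h]
  · by_cases hz' : P.result x y c = z'
    · simp [hz', h.symm]
    · simp [hz, hz']

variable {P} [Fintype X] [DecidableEq X] [Fintype Y] [DecidableEq Y] [Fintype Z] {f : X → Y → Z}

/-- A private protocol gives the same results when both inputs are changed as when one input is
changed, if changing only one input does not affect the value. -/
theorem IsPrivate.eq_of_computes (hP : P.IsPrivate f) {ε : ℝ} (hε : ε < 1 / 2)
    (hC : P.Computes f ε) {x x' : X} {y y' : Y} (hx : f x y = f x' y) (hy : f x y = f x y') :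
    f x' y' = f x y := by
  by_contra hne
  have hR := hP.rectangle hx hy le_rfl
  have hC' := hC x' y'
  cases h : P.turn P.rounds
  -- Privacy cannot give this directly, since the values at `(x', y)` and `(x', y')` are assumed to
  -- differ; the rectangle carries it over from `x`. Then at `(x', y)` two distinct results would
  -- each have probability above `1 / 2`.
  · have he : P.playerState P.rounds Player.al x' y = P.playerState P.rounds Player.al x' y' :=
      hR.reduced_eq (hP.playerState_al_eq le_rfl hy)
    have h1 : P.resultProb x' y (f x' y') = P.resultProb x' y' (f x' y') := by
      rw [P.resultProb_of_al h, P.resultProb_of_al h, he]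
    have h2 := P.resultProb_add_le_one x' y (fun h => hne (h.trans hx.symm))
    have h3 := hC x' y
    linarith
  · have he : P.playerState P.rounds Player.bob x y' = P.playerState P.rounds Player.bob x' y' :=
      (hR.symm (P.owner_eq_bob_iff _)).reduced_eq (hP.playerState_bob_eq le_rfl hx)
    have h1 : P.resultProb x y' (f x' y') = P.resultProb x' y' (f x' y') := by
      rw [P.resultProb_of_bob h, P.resultProb_of_bob h, he]
    have h2 := P.resultProb_add_le_one x y' (fun h => hne (h.trans hy.symm))
    have h3 := hC x y'
    linarith

end Necessity

end QuantumProtocol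

/-- A Boolean function is an exclusive-or if no rectangle has exactly one deviating value. -/
theorem exists_xor_of_forall {X Y : Type*} [Nonempty X] [Nonempty Y] {f : X → Y → Bool}
    (h : ∀ x x' y y', f x y = f x' y → f x y = f x y' → f x' y' = f x y) :
    ∃ (fA : X → Bool) (fB : Y → Bool), ∀ x y, f x y = xor (fA x) (fB y) := by
  obtain ⟨x₀⟩ := ‹Nonempty X›
  obtain ⟨y₀⟩ := ‹Nonempty Y›
  refine ⟨fun x => f x y₀, fun y => xor (f x₀ y₀) (f x₀ y), fun x y => ?_⟩
  -- Each corner serves once as base point; this excludes all patterns of odd parity.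
  have h1 := h x₀ x y₀ y
  have h2 := h x₀ x y y₀
  have h3 := h x x₀ y₀ y
  have h4 := h x x₀ y y₀
  revert h1 h2 h3 h4
  dsimp only
  generalize f x y = a
  generalize f x y₀ = b
  generalize f x₀ y = c
  generalize f x₀ y₀ = d
  revert a b c d
  decide

end QPriv
namespace QPriv

open Matrix

/-! ### A private protocol for exclusive-ors -/

section Sufficiency

/-- The unitary that adds the bit `b` to every qubit. -/
def flipGate {I : Type*} [Fintype I] [DecidableEq I] (b : Bool) : unitaryGroup (I → Bool) ℂ :=
  ⟨Matrix.of fun a c => if c = fun i => xor (a i) b then 1 else 0, by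
    rw [mem_unitaryGroup_iff]
    ext a a'
    have h : ((fun i => xor (a' i) b) = fun i => xor (a i) b) ↔ a = a' := by
      simp [funext_iff, eq_comm]
    by_cases haa : a = a'
    · subst haa
      simp [mul_apply, star_apply, apply_ite]
    · simp [mul_apply, star_apply, haa, apply_ite, h]⟩

theorem applyOn_mulVec_single {n : ℕ} (s : Fin n → Prop) [DecidablePred s]
    (U : Matrix ({i // s i} → Bool) ({i // s i} → Bool) ℂ) (c : Fin n → Bool) :
    applyOn s U *ᵥ Pi.single c 1 =
      fun a => if ∀ i, ¬ s i → a i = c i then U (fun i => a i) (fun i => c i) else 0 := by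
  rw [mulVec_single_one]
  rfl

theorem reduced_single {n : ℕ} (s : Fin n → Prop) [DecidablePred s] (c : Fin n → Bool) :
    reduced s (Pi.single c 1) =
      single (fun i : {i // s i} => c i) (fun i : {i // s i} => c i) 1 := by
  have h : ∀ (a : {i // s i} → Bool) d, glue s a d = c ↔
      a = (fun i : {i // s i} => c i) ∧ d = fun i : {i // ¬ s i} => c i := by
    intro a d
    constructor
    · rintro rfl
      exact ⟨(glue_restrict a d).symm, (glue_restrict_not a d).symm⟩
    · rintro ⟨rfl, rfl⟩
      exact glue_self c
  ext a b
  rw [reduced_eq, mul_apply]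
  simp only [asMatrix, of_apply, conjTranspose_apply, Pi.single_apply, h, single_apply]
  by_cases ha : a = fun i : {i // s i} => c i
  · by_cases hb : b = fun i : {i // s i} => c i
    · simp [ha, hb]
    · simp [hb, eq_comm (a := fun i : {i // s i} => c i)]
  · simp [ha, eq_comm (a := fun i : {i // s i} => c i)]

theorem reduced_zero {n : ℕ} (s : Fin n → Prop) [DecidablePred s] :
    reduced s (0 : (Fin n → Bool) → ℂ) = 0 := by
  ext
  simp [reduced]

variable {X Y : Type*}

/-- Al sends `fA x` to Bob, who announces `fA x ⊕ fB y`. -/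
def xorProtocol (fA : X → Bool) (fB : Y → Bool) : QuantumProtocol X Y Bool where
  qubits := 1
  rounds := 1
  turn t := if t = 0 then Player.al else Player.bob
  owner t _ := if t = 0 then Player.al else Player.bob
  owner_succ := by
    intro t ht i hi
    obtain rfl : t = 0 := by omega
    simp at hi
  opAl _ x := flipGate (fA x)
  opBob _ _ := 1
  -- A dummy value: `turn 1` is Bob, so he announces.
  outAl _ _ := false
  outBob y a := xor (a ⟨0, rfl⟩) (fB y)

namespace xorProtocol

variable (fA : X → Bool) (fB : Y → Bool)

theorem state_one (x : X) (y : Y) :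
    (xorProtocol fA fB).state x y 1 = Pi.single (fun _ => fA x) 1 := by
  have h : (xorProtocol fA fB).state x y 1 =
      applyOn (fun i => (xorProtocol fA fB).owner 0 i = Player.al) (flipGate (fA x)).1 *ᵥ
        Pi.single (fun _ => false) 1 := rfl
  rw [h, applyOn_mulVec_single]
  funext a
  have h1 : (∀ i, ¬ (xorProtocol fA fB).owner 0 i = Player.al → a i = false) :=
    fun i hi => absurd rfl hi
  rw [if_pos h1, Pi.single_apply]
  refine if_congr ?_ rfl rfl
  constructor
  · intro h2
    funext i
    have h3 : false = xor (a i) (fA x) := congrFun h2 ⟨i, rfl⟩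
    revert h3
    cases a i <;> cases fA x <;> simp
  · rintro rfl
    funext i
    simp

theorem state_two (x : X) (y : Y) :
    (xorProtocol fA fB).state x y 2 = Pi.single (fun _ => fA x) 1 := by
  have h : (xorProtocol fA fB).state x y 2 =
      applyOn (fun i => (xorProtocol fA fB).owner 1 i = Player.bob) 1 *ᵥ
        (xorProtocol fA fB).state x y 1 := rfl
  rw [h, applyOn_one_mulVec, state_one]

theorem finalBranch_eq (x : X) (y : Y) (z : Bool) :
    (xorProtocol fA fB).finalBranch x y z =
      if z = xor (fA x) (fB y) then
        (Pi.single (fun _ => fA x) 1 : (Fin (xorProtocol fA fB).qubits → Bool) → ℂ) else 0 := by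
  funext c
  have h : (xorProtocol fA fB).finalBranch x y z c =
      if xor (c ⟨0, Nat.one_pos⟩) (fB y) = z then (xorProtocol fA fB).state x y 2 c else 0 := rfl
  rw [h, state_two]
  by_cases hc : c = fun _ => fA x
  · subst hc
    by_cases hz : z = xor (fA x) (fB y)
    · rw [if_pos hz.symm, if_pos hz]
    · rw [if_neg (Ne.symm hz), if_neg hz]
      rfl
  · have h0 : (Pi.single (fun _ => fA x) 1 : (Fin (xorProtocol fA fB).qubits → Bool) → ℂ) c = 0 :=
      Pi.single_eq_of_ne hc _
    rw [h0, ite_self]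
    by_cases hz : z = xor (fA x) (fB y)
    · rw [if_pos hz, h0]
    · rw [if_neg hz]
      rfl

theorem resultProb_eq_one (x : X) (y : Y) :
    (xorProtocol fA fB).resultProb x y (xor (fA x) (fB y)) = 1 := by
  rw [QuantumProtocol.resultProb, finalBranch_eq, if_pos rfl,
    Finset.sum_eq_single (fun _ => fA x)]
  · simp
  · intro b _ hb
    simp [hb]
  · simp

/-- The bit on the qubit at time `t`. -/
def bit (t : ℕ) (x : X) : Bool := if t = 0 then false else fA x

/-- The formula also covers the player without the qubit, whose register has a single configuration.
-/
theorem playerState_eq {t : ℕ} (ht : t ≤ 1) (p : Player) (x : X) (y : Y) :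
    (xorProtocol fA fB).playerState t p x y =
      single (fun _ => bit fA t x) (fun _ => bit fA t x) 1 := by
  rw [QuantumProtocol.playerState]
  interval_cases t
  · exact reduced_single (fun i => (xorProtocol fA fB).owner 0 i = p) fun _ => false
  · rw [state_one]
    exact reduced_single (fun i => (xorProtocol fA fB).owner 1 i = p) fun _ => fA x

theorem finalPlayerState_eq (p : Player) (x : X) (y : Y) :
    (xorProtocol fA fB).finalPlayerState p x y =
      single (fun _ => fA x, xor (fA x) (fB y)) (fun _ => fA x, xor (fA x) (fB y)) 1 := by
  ext ⟨a, z⟩ ⟨b, w⟩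
  simp only [QuantumProtocol.finalPlayerState, of_apply, finalBranch_eq]
  by_cases hz : z = xor (fA x) (fB y)
  · rw [if_pos hz, reduced_single, single_apply, single_apply]
    by_cases hw : z = w
    · simp [← hw, ← hz]
    · simp [hw, ← hz]
  · rw [if_neg hz, reduced_zero, single_apply]
    simp [Ne.symm hz]

variable [Fintype X] [DecidableEq X] [Fintype Y] [DecidableEq Y] {f : X → Y → Bool}

theorem divulged_playerState (hf : ∀ x y, f x y = xor (fA x) (fB y)) (μ : X × Y → ℝ) (p : Player)
    {t : ℕ} (ht : t ≤ 1) :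
    QuantumProtocol.divulged f μ p ((xorProtocol fA fB).playerState t p) = 0 := by
  cases p
  · simp only [QuantumProtocol.divulged, playerState_eq fA fB ht]
    exact condMutualInfo_jointState_single _ (fun y x => f x y) fun x _ _ => bit fA t x
  -- Bob's bit is rewritten as a function of `y` and the value, as
  -- `condMutualInfo_jointState_single` requires.
  · have h : ∀ x y, bit fA t x = if t = 0 then false else xor (f x y) (fB y) := by
      intro x y
      simp [bit, hf]
    have h1 : (xorProtocol fA fB).playerState t Player.bob = fun x y =>
        single (fun _ => if t = 0 then false else xor (f x y) (fB y))
          (fun _ => if t = 0 then false else xor (f x y) (fB y)) 1 := by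
      funext x y
      rw [playerState_eq fA fB ht, h x y]
    rw [QuantumProtocol.divulged, h1]
    exact condMutualInfo_jointState_single _ f fun y z _ => if t = 0 then false else xor z (fB y)

theorem divulged_finalPlayerState (hf : ∀ x y, f x y = xor (fA x) (fB y)) (μ : X × Y → ℝ)
    (p : Player) :
    QuantumProtocol.divulged f μ p ((xorProtocol fA fB).finalPlayerState p) = 0 := by
  cases p
  · simp only [QuantumProtocol.divulged, finalPlayerState_eq, ← hf]
    exact condMutualInfo_jointState_single _ (fun y x => f x y) fun x z => (fun _ => fA x, z)
  · have h1 : (xorProtocol fA fB).finalPlayerState Player.bob = fun x y =>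
        single (fun _ => xor (f x y) (fB y), f x y) (fun _ => xor (f x y) (fB y), f x y) 1 := by
      funext x y
      rw [finalPlayerState_eq, hf]
      simp
    rw [QuantumProtocol.divulged, h1]
    exact condMutualInfo_jointState_single _ f fun y z => (fun _ => xor z (fB y), z)

theorem isPrivate [Nonempty X] [Nonempty Y] (hf : ∀ x y, f x y = xor (fA x) (fB y)) :
    (xorProtocol fA fB).IsPrivate f := by
  refine le_antisymm ?_ ?_
  · refine iSup₂_le fun μ _ => iSup_le fun p => sup_le (iSup₂_le fun t ht => ?_) ?_
    · rw [divulged_playerState fA fB hf μ p ht]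
      rfl
    · rw [divulged_finalPlayerState fA fB hf μ p]
      rfl
  -- A point mass keeps the supremum from being over no distributions, where it would be `⊥` instead
  -- of `0`.
  · obtain ⟨i⟩ := (inferInstance : Nonempty (X × Y))
    refine le_iSup₂_of_le (Pi.single i 1) (single_mem_stdSimplex ℝ i)
      (le_iSup_of_le Player.al (le_sup_of_le_right ?_))
    rw [divulged_finalPlayerState fA fB hf _ Player.al]
    rfl

end xorProtocol

end Sufficiency

end QPriv

theorem mainTheorem9 {X Y : Type*} [Fintype X] [DecidableEq X] [Nonempty X]
    [Fintype Y] [DecidableEq Y] [Nonempty Y] (f : X → Y → Bool)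
    (ε : ℝ) (hε₀ : 0 ≤ ε) (hε : ε < 1 / 2) :
    (∃ P : QPriv.QuantumProtocol X Y Bool, P.Computes f ε ∧ P.IsPrivate f) ↔
      ∃ (fA : X → Bool) (fB : Y → Bool), ∀ x y, f x y = xor (fA x) (fB y) := by
  constructor
  · rintro ⟨P, hC, hP⟩
    exact QPriv.exists_xor_of_forall fun x x' y y' hx hy => hP.eq_of_computes hε hC hx hy
  · rintro ⟨fA, fB, hf⟩
    refine ⟨QPriv.xorProtocol fA fB, fun x y => ?_, QPriv.xorProtocol.isPrivate fA fB hf⟩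
    rw [hf, QPriv.xorProtocol.resultProb_eq_one]
    linarith
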